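/- For a semigroup $S$ and an integer $r\ge 1$ let $S^r=\{s_1s_2\cdots s_r : s_1,\dots,s_r\in S\}$; $S$ is \emph{nilpotent of degree $3$} if $r=3$ is the least integer $r\ge1$ with $|S^r|=1$. For a partition $j$ of a non-negative integer $s$ (written $j\vdash s$; the integer $0$ has exactly one, empty, partition), let $j_i$ denote the number of summands of $j$ equal to $i$. For integers $1\le q<p$ put \[ N(p,q)=\sum_{j\vdash q-1}\ \sum_{k\vdash p-q}\Bigl(\prod_{i=1}^{q-1}j_i!\,i^{j_i}\ \prod_{i=1}^{p-q}k_i!\,i^{k_i}\Bigr)^{-1}\prod_{a,b=1}^{p-q}\Bigl(1+\sum_{d\mid\operatorname{lcm}(a,b)}d\,j_d\Bigr)^{k_ak_b\gcd(a,b)} . \] Then for every integer $n\ge1$ the number of nilpotent semigroups of degree $3$ and order $n$ up to isomorphism equals \[ \sum_{m=2}^{a(n)}\bigl(N(n,m)-N(n-1,m-1)\bigr),\qquad a(n)=\Bigl\lfloor n+\tfrac12-\sqrt{n-\tfrac34}\,\Bigr\rfloor , \] where a sum with no terms is $0$. -/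

import Mathlib

namespace NilpotentCount

/-- `S^r = {s₁ s₂ ⋯ s_r}` for `r ≥ 1`; the value at `r = 0` is a placeholder and is never used. -/
def productSet (S : Type*) [Semigroup S] : ℕ → Set S
  | 0 => ∅
  | 1 => Set.univ
  | r + 2 => {x | ∃ y ∈ productSet S (r + 1), ∃ s : S, x = y * s}

/-- `r` is the least positive integer with `|S^r| = 1`. -/
def IsNilpotentOfDegree (S : Type*) [Semigroup S] (r : ℕ) : Prop :=
  IsLeast {t : ℕ | 1 ≤ t ∧ (productSet S t).ncard = 1} r

/-- The semigroup structures on an `n`-element set that are nilpotent of degree `3`. -/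
def NilThree (n : ℕ) : Type :=
  {s : Semigroup (Fin n) // @IsNilpotentOfDegree (Fin n) s 3}

/-- Two such structures are identified when there is an isomorphism between them. -/
def isoSetoid (n : ℕ) : Setoid (NilThree n) where
  r s t := Nonempty (@MulEquiv (Fin n) (Fin n) s.1.toMul t.1.toMul)
  iseqv :=
    { refl := fun s => ⟨@MulEquiv.refl (Fin n) s.1.toMul⟩
      symm := fun {s t} ⟨f⟩ => ⟨@MulEquiv.symm (Fin n) (Fin n) s.1.toMul t.1.toMul f⟩
      trans := fun {s t u} ⟨f⟩ ⟨g⟩ =>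
        ⟨@MulEquiv.trans (Fin n) (Fin n) (Fin n) s.1.toMul t.1.toMul u.1.toMul f g⟩ }

/-- The number of isomorphism classes of nilpotent semigroups of degree `3` and order `n`. -/
noncomputable def numNilThreeUpToIso (n : ℕ) : ℕ :=
  Nat.card (Quotient (isoSetoid n))

/-- The multiplicity `j_i` of the summand `i` in the partition `j`. -/
def mult {n : ℕ} (j : Nat.Partition n) (i : ℕ) : ℕ := j.parts.count i

/-- The number `N(p,q)`, meant for `1 ≤ q < p`. -/
def N (p q : ℕ) : ℚ :=
  ∑ j : Nat.Partition (q - 1), ∑ k : Nat.Partition (p - q),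
    ((∏ i ∈ Finset.Icc 1 (q - 1), ((mult j i).factorial : ℚ) * (i : ℚ) ^ mult j i) *
      ∏ i ∈ Finset.Icc 1 (p - q), ((mult k i).factorial : ℚ) * (i : ℚ) ^ mult k i)⁻¹ *
    ∏ a ∈ Finset.Icc 1 (p - q), ∏ b ∈ Finset.Icc 1 (p - q),
      (1 + ∑ d ∈ (Nat.lcm a b).divisors, (d : ℚ) * (mult j d : ℚ)) ^
        (mult k a * mult k b * Nat.gcd a b)

/-- `a(n) = ⌊n + 1/2 - √(n - 3/4)⌋`. -/
noncomputable def upper (n : ℕ) : ℕ :=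
  ⌊(n : ℝ) + 1 / 2 - √((n : ℝ) - 3 / 4)⌋₊

end NilpotentCount

namespace NilpotentCount

open Equiv Function Finset

/-! ### Cycle lengths of a permutation as minimal periods of its points. -/

section Periods

/-! Let S be nilpotent of degree 3 with zero z, let A be the complement of S², and let B be S²
without z. A product with a factor in S² is z, so S amounts to a table A × A → B ∪ {0}. Every table
is associative, and its square is all of B ∪ {0} exactly when each element of B occurs
(`Table.Covering`). Isomorphisms are relabellings of A and B, so the classes with |S²| = m are the
orbits of `Perm A × Perm B` on covering tables with |A| = n - m, |B| = m - 1
(`card_squareCardClass_eq`).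

Orbits of non-covering tables correspond to orbits of tables with one value fewer, hence the
difference of two counts (`card_coveringClasses_add`). All tables are counted by Burnside
(`numTables_eq_sum`): a table fixed by (τ, σ) is an equivariant map, that is, a choice for each
orbit of τ × τ, of length l say, of a point fixed by σ^l (`card_equivariant`). An a-cycle times a
b-cycle splits into gcd(a, b) orbits of length lcm(a, b), which gives the product in N. Finally,
covering forces m - 1 ≤ (n - m)², and this is m ≤ a(n) (`le_upper_iff`). -/

theorem minimalPeriod_perm_pos {α : Type*} [Finite α] (σ : Perm α) (x : α) : 0 < minimalPeriod σ x := by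
  apply minimalPeriod_pos_of_mem_periodicPts
  refine ⟨orderOf σ, orderOf_pos σ, ?_⟩
  rw [IsPeriodicPt, ← Perm.coe_pow, pow_orderOf_eq_one]
  exact isFixedPt_id x

theorem minimalPeriod_prodCongr {α β : Type*} (σ : Perm α) (τ : Perm β) (p : α × β) :
    minimalPeriod (σ.prodCongr τ) p = (minimalPeriod σ p.1).lcm (minimalPeriod τ p.2) := by
  rw [← minimalPeriod_prodMap]; rfl

variable {α : Type*} [Fintype α] [DecidableEq α]

theorem minimalPeriod_eq_card_support_cycleOf (σ : Perm α) {x : α} (hx : x ∈ σ.support) :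
    minimalPeriod σ x = #(σ.cycleOf x).support := by
  have hx' : x ∈ (σ.cycleOf x).support := by
    rw [Perm.mem_support_cycleOf_iff' (Perm.mem_support.mp hx)]
  apply Nat.dvd_right_iff_eq.mp
  intro n
  rw [← (σ.isCycleOn_support_cycleOf x).pow_apply_eq hx', ← isPeriodicPt_iff_minimalPeriod_dvd,
    IsPeriodicPt, IsFixedPt, Perm.coe_pow]

theorem card_minimalPeriod_eq (σ : Perm α) (d : ℕ) :
    #{x | minimalPeriod σ x = d} = d * σ.partition.parts.count d := by
  rcases Nat.lt_trichotomy d 1 with h | rfl | h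
  -- The cases d ≤ 1 are separate because `cycleType` records only lengths at least 2; the parts 1
  -- of `partition` are added for the fixed points.
  · obtain rfl : d = 0 := by omega
    simp [(minimalPeriod_perm_pos σ _).ne']
  · rw [Perm.parts_partition, Multiset.count_add, Multiset.count_eq_zero_of_notMem, zero_add,
      Multiset.count_replicate_self, one_mul, ← card_compl]
    · congr 1
      ext x
      simp [minimalPeriod_eq_one_iff_isFixedPt, IsFixedPt]
    · intro h
      exact absurd (Perm.two_le_of_mem_cycleType h) (by norm_num)
  · have hset : ({x | minimalPeriod σ x = d} : Finset α) =
        (σ.cycleFactorsFinset.filter fun c => #c.support = d).biUnion Perm.support := by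
      ext x
      simp only [mem_filter, mem_univ, true_and, mem_biUnion]
      constructor
      · intro hx
        have hxs : x ∈ σ.support := by
          rw [Perm.mem_support]
          intro hfix
          have : minimalPeriod σ x = 1 := minimalPeriod_eq_one_iff_isFixedPt.mpr hfix
          omega
        refine ⟨σ.cycleOf x, ⟨Perm.cycleOf_mem_cycleFactorsFinset_iff.mpr hxs, ?_⟩, ?_⟩
        · rw [← minimalPeriod_eq_card_support_cycleOf σ hxs, hx]
        · exact (Perm.mem_support_cycleOf_iff' (Perm.mem_support.mp hxs)).mpr
            (Perm.SameCycle.refl _ _)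
      · rintro ⟨c, ⟨hc, hcd⟩, hxc⟩
        have hxs : x ∈ σ.support := Perm.mem_cycleFactorsFinset_support_le hc hxc
        rw [minimalPeriod_eq_card_support_cycleOf σ hxs, ← Perm.cycle_is_cycleOf hxc hc, hcd]
    rw [hset, card_biUnion, sum_congr rfl (g := fun _ => d), sum_const, smul_eq_mul, mul_comm]
    · congr 1
      rw [Perm.parts_partition, Multiset.count_add, Multiset.count_replicate, if_neg h.ne,
        add_zero, Perm.cycleType_def, Multiset.count_map, card_def, filter_val]
      simp only [comp_apply, eq_comm]
    · intro c hc
      exact (mem_filter.mp hc).2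
    · intro c hc c' hc' hne
      exact ((Perm.cycleFactorsFinset_pairwise_disjoint σ) (mem_filter.mp hc).1
        (mem_filter.mp hc').1 hne).disjoint_support

theorem card_pow_fixed (σ : Perm α) {l : ℕ} (hl : l ≠ 0) :
    #{x | (σ ^ l) x = x} = ∑ d ∈ l.divisors, d * σ.partition.parts.count d := by
  have h : ∀ x ∈ ({x | (σ ^ l) x = x} : Finset α), minimalPeriod σ x ∈ l.divisors := by
    intro x hx
    rw [Nat.mem_divisors]
    refine ⟨?_, hl⟩
    rw [← isPeriodicPt_iff_minimalPeriod_dvd, IsPeriodicPt, IsFixedPt, ← Perm.coe_pow]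
    exact (mem_filter.mp hx).2
  rw [card_eq_sum_card_fiberwise h]
  refine sum_congr rfl fun d hd => ?_
  rw [← card_minimalPeriod_eq]
  congr 1
  ext x
  simp only [mem_filter, mem_univ, true_and, and_iff_right_iff_imp]
  rintro rfl
  have := isPeriodicPt_iff_minimalPeriod_dvd.mpr (Nat.dvd_of_mem_divisors hd)
  rwa [IsPeriodicPt, IsFixedPt, ← Perm.coe_pow] at this

end Periods

/-! ### Counting maps that intertwine two permutations. -/

section Equivariant

variable {X Y : Type*}

/-- The orbits of a permutation. -/
abbrev Orbits (τ : Perm X) : Type _ := MulAction.orbitRel.Quotient (Subgroup.zpowers τ) X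

/-- Length of an orbit of a permutation. -/
noncomputable def orbitLength (τ : Perm X) (ω : Orbits τ) : ℕ := minimalPeriod τ ω.out

theorem mk_eq_iff_exists_zpow (τ : Perm X) (x y : X) :
    (Quotient.mk'' x : Orbits τ) = Quotient.mk'' y ↔ ∃ n : ℤ, (τ ^ n) y = x := by
  rw [Quotient.eq'']
  change x ∈ MulAction.orbit _ y ↔ _
  constructor
  · rintro ⟨⟨_, n, rfl⟩, h⟩
    exact ⟨n, h⟩
  · rintro ⟨n, h⟩
    exact ⟨⟨τ ^ n, n, rfl⟩, h⟩

theorem exists_zpow_out (τ : Perm X) (x : X) :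
    ∃ n : ℤ, (τ ^ n) (Quotient.mk'' x : Orbits τ).out = x := by
  rw [← mk_eq_iff_exists_zpow]
  exact (Quotient.out_eq' _).symm

theorem zpow_apply_eq_iff_dvd (τ : Perm X) (x : X) (n : ℤ) :
    (τ ^ n) x = x ↔ (minimalPeriod τ x : ℤ) ∣ n :=
  MulAction.zpow_smul_eq_iff_minimalPeriod_dvd (a := τ) (b := x)

/-- A map intertwining two permutations amounts to the choice, for every orbit, of the image of
a representative among the points fixed by the appropriate power. -/
noncomputable def equivariantEquiv (τ : Perm X) (σ : Perm Y) :
    {f : X → Y // ∀ x, f (τ x) = σ (f x)} ≃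
      ((ω : Orbits τ) → {y : Y // (σ ^ orbitLength τ ω) y = y}) := by
  have key : ∀ f : {f : X → Y // ∀ x, f (τ x) = σ (f x)}, ∀ (n : ℤ) (x : X),
      f.1 ((τ ^ n) x) = (σ ^ n) (f.1 x) := by
    intro f n
    induction n with
    | zero => simp
    | succ n ih => intro x; rw [zpow_add_one, zpow_add_one, Perm.mul_apply, Perm.mul_apply, ih, f.2]
    | pred n ih =>
      intro x
      rw [zpow_sub_one, zpow_sub_one, Perm.mul_apply, Perm.mul_apply, ih]
      congr 1
      rw [Perm.eq_inv_iff_eq, ← f.2, Equiv.Perm.coe_inv, Equiv.apply_symm_apply]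
  refine Equiv.ofBijective (fun f ω => ⟨f.1 ω.out, ?_⟩) ⟨?_, ?_⟩
  · have h := key f (orbitLength τ ω) ω.out
    have h' : (τ ^ (orbitLength τ ω : ℤ)) ω.out = ω.out :=
      (zpow_apply_eq_iff_dvd τ _ _).mpr dvd_rfl
    rw [h'] at h
    exact_mod_cast h.symm
  · intro f g hfg
    ext x
    obtain ⟨n, hn⟩ := exists_zpow_out τ x
    have := congrArg Subtype.val (congrFun hfg (Quotient.mk'' x))
    simp only at this
    rw [← hn, key, key, this]
  · intro g
    choose e he using exists_zpow_out τ
    -- Exponents reaching the same point differ by a multiple of the orbit length, and that power of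
    -- σ fixes the chosen value; so the choice of `e` is immaterial.
    have wd : ∀ (ω : Orbits τ) (m n : ℤ), (τ ^ m) ω.out = (τ ^ n) ω.out →
        (σ ^ m) (g ω).1 = (σ ^ n) (g ω).1 := by
      intro ω m n h
      have h1 : (τ ^ (m - n)) ω.out = ω.out := by
        rw [sub_eq_neg_add, zpow_add, Perm.mul_apply, h, ← Perm.mul_apply, ← zpow_add]
        simp
      rw [zpow_apply_eq_iff_dvd] at h1
      obtain ⟨c, hc⟩ := h1
      have h2 : (σ ^ (m - n)) (g ω).1 = (g ω).1 := by
        rw [hc, zpow_mul]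
        apply Perm.zpow_apply_eq_self_of_apply_eq_self
        exact_mod_cast (g ω).2
      have : m = n + (m - n) := by ring
      rw [this, zpow_add, Perm.mul_apply, h2]
    refine ⟨⟨fun x => (σ ^ e x) (g (Quotient.mk'' x)).1, ?_⟩, ?_⟩
    · intro x
      have hx : (Quotient.mk'' (τ x) : Orbits τ) = Quotient.mk'' x :=
        (mk_eq_iff_exists_zpow τ _ _).mpr ⟨1, by simp⟩
      have h1 := he (τ x)
      simp only
      rw [hx] at h1 ⊢
      rw [← Perm.mul_apply, ← zpow_one_add]
      apply wd
      rw [h1, zpow_one_add, Perm.mul_apply, he]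
    · funext ω
      apply Subtype.ext
      have h := he ω.out
      have hω : (Quotient.mk'' ω.out : Orbits τ) = ω := Quotient.out_eq' ω
      simp only
      rw [hω] at h ⊢
      simpa using wd ω _ 0 (by simpa using h)

/-- Powers of τ commute, so all points of an orbit are fixed by the same powers. -/
theorem orbitLength_mk (τ : Perm X) (x : X) :
    orbitLength τ (Quotient.mk'' x) = minimalPeriod τ x := by
  obtain ⟨n, hn⟩ := exists_zpow_out τ x
  apply Nat.dvd_right_iff_eq.mp
  intro m
  rw [orbitLength, ← Int.natCast_dvd_natCast, ← Int.natCast_dvd_natCast, ← zpow_apply_eq_iff_dvd,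
    ← zpow_apply_eq_iff_dvd]
  conv_rhs => rw [← hn]
  rw [← Perm.mul_apply, ← zpow_add, add_comm, zpow_add, Perm.mul_apply, EmbeddingLike.apply_eq_iff_eq]

variable [Fintype X]

noncomputable instance (τ : Perm X) : Fintype (Orbits τ) := Fintype.ofFinite _

open Classical in
theorem card_fiber_orbits (τ : Perm X) (ω : Orbits τ) :
    #{x | (Quotient.mk'' x : Orbits τ) = ω} = orbitLength τ ω := by
  have h := MulAction.minimalPeriod_eq_card (a := τ) (b := ω.out)
  rw [orbitLength]
  refine Eq.trans ?_ h.symm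
  rw [← Set.toFinset_card]
  congr 1
  ext x
  rw [Set.mem_toFinset, mem_filter, ← MulAction.orbitRel_apply]
  simp only [mem_univ, true_and]
  conv_lhs => rw [← Quotient.out_eq' ω]
  exact Quotient.eq''

open Classical in
theorem length_mul_card_orbits (τ : Perm X) (l : ℕ) :
    l * #{ω : Orbits τ | orbitLength τ ω = l} = #{x | minimalPeriod τ x = l} := by
  rw [card_eq_sum_card_fiberwise (f := fun x => (Quotient.mk'' x : Orbits τ))
    (t := {ω : Orbits τ | orbitLength τ ω = l}), mul_comm, ← smul_eq_mul, ← sum_const]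
  · refine sum_congr rfl fun ω hω => ?_
    have hω' := (mem_filter.mp hω).2
    refine hω'.symm.trans ?_
    rw [← card_fiber_orbits, filter_filter]
    congr 1
    ext x
    simp only [mem_filter, mem_univ, true_and, iff_and_self]
    intro h
    rw [← hω', ← h, orbitLength_mk]
  · intro x hx
    simpa [orbitLength_mk] using hx

theorem card_equivariant [Fintype Y] [DecidableEq Y] (τ : Perm X) (σ : Perm Y) :
    Nat.card {f : X → Y // ∀ x, f (τ x) = σ (f x)} =
      ∏ ω : Orbits τ, #{y | (σ ^ orbitLength τ ω) y = y} := by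
  rw [Nat.card_congr (equivariantEquiv τ σ), Nat.card_pi]
  refine prod_congr rfl fun ω _ => ?_
  rw [Nat.card_eq_fintype_card, Fintype.card_subtype]

end Equivariant

/-! ### Permutations with a given cycle structure. -/

section PartitionCount

variable {α : Type*} [Fintype α] [DecidableEq α]

/-- The order `∏ jᵢ! i^{jᵢ}` of the centralizer of a permutation with cycle structure `j`. -/
def centralizerOrder {c : ℕ} (j : Nat.Partition c) : ℕ :=
  ∏ i ∈ Icc 1 c, (mult j i).factorial * i ^ mult j i

theorem centralizerOrder_pos {c : ℕ} (j : Nat.Partition c) : 0 < centralizerOrder j :=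
  prod_pos fun _ hi => Nat.mul_pos (Nat.factorial_pos _) (Nat.pow_pos (mem_Icc.mp hi).1)

theorem parts_eq_filter_add_replicate {c : ℕ} (j : Nat.Partition c) :
    j.parts = j.parts.filter (2 ≤ ·) + Multiset.replicate (mult j 1) 1 := by
  ext i
  rw [Multiset.count_add, Multiset.count_filter, Multiset.count_replicate]
  rcases Nat.lt_trichotomy i 1 with h | rfl | h
  · obtain rfl : i = 0 := by omega
    simpa using fun h => (j.parts_pos h).ne' rfl
  · simp [mult]
  · rw [if_pos (show 2 ≤ i from h), if_neg (by omega), add_zero]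

theorem partition_eq_iff_cycleType_eq (σ : Perm α) (j : Nat.Partition (Fintype.card α)) :
    σ.partition = j ↔ σ.cycleType = j.parts.filter (2 ≤ ·) := by
  constructor
  · rintro rfl
    exact Perm.filter_parts_partition_eq_cycleType.symm
  · intro h
    have hs := j.parts_sum
    rw [parts_eq_filter_add_replicate j, ← h, Multiset.sum_add, Multiset.sum_replicate,
      Perm.sum_cycleType] at hs
    ext1
    rw [Perm.parts_partition, parts_eq_filter_add_replicate j, ← h]
    congr 2
    simp only [smul_eq_mul, mul_one] at hs
    omega

theorem mem_Icc_of_mem_parts {c i : ℕ} {j : Nat.Partition c} (hi : i ∈ j.parts) :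
    i ∈ Icc 1 c :=
  mem_Icc.mpr ⟨j.parts_pos hi, j.le_of_mem_parts hi⟩

/-- The count by `cycleType` ignores parts 1 and carries a factor `(card - sum)!` for the fixed
points; that factor is j₁!, and parts 1 do not affect the product of the parts. -/
theorem card_partition_eq_mul (j : Nat.Partition (Fintype.card α)) :
    #{σ : Perm α | σ.partition = j} * centralizerOrder j = (Fintype.card α).factorial := by
  set m := j.parts.filter (2 ≤ ·) with hm
  have hj : j.parts = m + Multiset.replicate (mult j 1) 1 := parts_eq_filter_add_replicate j
  have hsum : m.sum + mult j 1 = Fintype.card α := by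
    have := j.parts_sum
    rw [hj] at this
    simpa using this
  have h := Perm.card_of_cycleType_mul_eq α m
  rw [if_pos ⟨by omega, fun a ha => (Multiset.mem_filter.mp ha).2⟩] at h
  rw [← h]
  simp_rw [partition_eq_iff_cycleType_eq]
  congr 1
  have hprod : m.prod = ∏ i ∈ Icc 1 (Fintype.card α), i ^ mult j i := by
    have h1 : m.prod = j.parts.prod := by rw [hj]; simp
    rw [h1]
    exact prod_multiset_count_of_subset _ _ fun i hi =>
      mem_Icc_of_mem_parts (Multiset.mem_toFinset.mp hi)
  have hfact : ∏ i ∈ Icc 1 (Fintype.card α), (mult j i).factorial =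
      (mult j 1).factorial * ∏ i ∈ m.toFinset, (m.count i).factorial := by
    have h1 : 1 ∉ m.toFinset := by simp [hm]
    have h2 : ∀ i ∈ m.toFinset, (m.count i).factorial = (mult j i).factorial := by
      intro i hi
      rw [Multiset.mem_toFinset, hm, Multiset.mem_filter] at hi
      rw [hm, Multiset.count_filter, if_pos hi.2, mult]
    rw [prod_congr rfl h2, ← prod_insert (f := fun i => (mult j i).factorial) h1]
    have h3 : ∀ s : Finset ℕ, (∀ i ∈ j.parts, i ∈ s) →
        ∏ i ∈ s, (mult j i).factorial = ∏ i ∈ j.parts.toFinset, (mult j i).factorial := by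
      intro s hs
      symm
      refine prod_subset (fun i hi => hs i (Multiset.mem_toFinset.mp hi)) fun i _ hi => ?_
      rw [mult, Multiset.count_eq_zero_of_notMem (by simpa using hi), Nat.factorial_zero]
    rw [h3 _ fun i => mem_Icc_of_mem_parts]
    refine (h3 _ fun i hi => ?_).symm
    rw [mem_insert, Multiset.mem_toFinset, hm, Multiset.mem_filter]
    have := j.parts_pos hi
    by_cases h : i = 1
    · exact Or.inl h
    · exact Or.inr ⟨hi, by omega⟩
  rw [centralizerOrder, prod_mul_distrib, ← hprod, hfact,
    show Fintype.card α - m.sum = mult j 1 by omega]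
  ring

theorem sum_perm_partition (F : Nat.Partition (Fintype.card α) → ℚ) :
    ∑ σ : Perm α, F σ.partition =
      (Fintype.card α).factorial * ∑ j, (centralizerOrder j : ℚ)⁻¹ * F j := by
  rw [← sum_fiberwise univ (fun σ : Perm α => σ.partition), mul_sum]
  refine sum_congr rfl fun j _ => ?_
  rw [sum_congr rfl (g := fun _ => F j) fun σ hσ => by rw [(mem_filter.mp hσ).2], sum_const,
    nsmul_eq_mul, ← card_partition_eq_mul j]
  have : (centralizerOrder j : ℚ) ≠ 0 := by exact_mod_cast (centralizerOrder_pos j).ne'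
  push_cast
  field_simp

end PartitionCount

/-! ### Burnside count of all tables. -/

section Tables

variable {A B : Type*}

/-- Multiplication tables on `A` with values in `B` together with an adjoined zero. -/
def Table (A B : Type*) : Type _ := A × A → Option B

instance [Finite A] [Finite B] : Finite (Table A B) := inferInstanceAs (Finite (A × A → Option B))

instance : MulAction (Perm A × Perm B) (Table A B) where
  smul g f := fun p => (f (g.1⁻¹ p.1, g.1⁻¹ p.2)).map g.2
  one_smul f := by
    funext p
    change (f _).map _ = _
    simp
  mul_smul g h f := by
    funext p
    change (f _).map _ = Option.map _ ((f _).map _)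
    simp [Option.map_map]

theorem smul_table_apply (g : Perm A × Perm B) (f : Table A B) (p : A × A) :
    (g • f) p = (f (g.1⁻¹ p.1, g.1⁻¹ p.2)).map g.2 := rfl

theorem smul_table_eq_iff (g : Perm A × Perm B) (f f' : Table A B) :
    g • f = f' ↔ ∀ x y, f' (g.1 x, g.1 y) = (f (x, y)).map g.2 := by
  constructor
  · rintro rfl x y
    simp [smul_table_apply]
  · intro h
    funext p
    rw [smul_table_apply, ← h]
    simp

theorem optionCongr_pow (σ : Perm B) (l : ℕ) :
    (optionCongr σ : Perm (Option B)) ^ l = optionCongr (σ ^ l) := by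
  induction l with
  | zero => ext x; simp
  | succ l ih =>
    rw [pow_succ, ih, pow_succ]
    ext x
    cases x <;> simp

variable [Fintype A] [DecidableEq A] [Fintype B] [DecidableEq B]

theorem card_optionCongr_pow_fixed (σ : Perm B) {l : ℕ} (hl : l ≠ 0) :
    #{y | ((optionCongr σ : Perm (Option B)) ^ l) y = y} =
      1 + ∑ d ∈ l.divisors, d * mult σ.partition d := by
  have : ({y | ((optionCongr σ : Perm (Option B)) ^ l) y = y} : Finset (Option B)) =
      insertNone {y | (σ ^ l) y = y} := by
    ext y
    rw [optionCongr_pow]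
    cases y <;> simp
  rw [this, card_insertNone, card_pow_fixed σ hl, add_comm]
  rfl

/-- The number of tables fixed by a pair of permutations of cycle structures `k` and `j`. -/
def fixedCount {a b : ℕ} (k : Nat.Partition a) (j : Nat.Partition b) : ℕ :=
  ∏ x ∈ Icc 1 a, ∏ y ∈ Icc 1 a,
    (1 + ∑ d ∈ (Nat.lcm x y).divisors, d * mult j d) ^ (mult k x * mult k y * Nat.gcd x y)

/-- The pairs with periods x and y number x kₓ · y k_y and all have period lcm(x, y), so they form
kₓ k_y gcd(x, y) orbits. -/
theorem card_orbits_prod (τ : Perm A) {l : ℕ} (hl : l ≠ 0) :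
    #{ω : Orbits (τ.prodCongr τ) | orbitLength _ ω = l} =
      ∑ q ∈ (Icc 1 (Fintype.card A) ×ˢ Icc 1 (Fintype.card A)) with q.1.lcm q.2 = l,
        mult τ.partition q.1 * mult τ.partition q.2 * q.1.gcd q.2 := by
  apply Nat.eq_of_mul_eq_mul_left (Nat.pos_of_ne_zero hl)
  rw [length_mul_card_orbits, mul_sum, card_eq_sum_card_fiberwise
    (f := fun p : A × A => (minimalPeriod τ p.1, minimalPeriod τ p.2))
    (t := {q ∈ Icc 1 (Fintype.card A) ×ˢ Icc 1 (Fintype.card A) | q.1.lcm q.2 = l})]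
  · refine sum_congr rfl fun q hq => ?_
    have hq' := (mem_filter.mp hq).2
    have : ({p ∈ ({p | minimalPeriod (τ.prodCongr τ) p = l} : Finset (A × A)) |
        (minimalPeriod τ p.1, minimalPeriod τ p.2) = q}) =
        ({x | minimalPeriod τ x = q.1} : Finset A) ×ˢ
          ({x | minimalPeriod τ x = q.2} : Finset A) := by
      ext p
      simp only [mem_filter, mem_univ, true_and, mem_product, minimalPeriod_prodCongr,
        Prod.ext_iff, and_iff_right_iff_imp]
      rintro ⟨h1, h2⟩
      rw [h1, h2, hq']
    rw [this, card_product, card_minimalPeriod_eq, card_minimalPeriod_eq, ← hq']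
    have := Nat.gcd_mul_lcm q.1 q.2
    simp only [mult]
    calc _ = q.1 * q.2 * (τ.partition.parts.count q.1 * τ.partition.parts.count q.2) := by ring
      _ = _ := by rw [← this]; ring
  · intro p hp
    have hp' := (mem_filter.mp hp).2
    have hle : ∀ x, minimalPeriod τ x ∈ Icc 1 (Fintype.card A) := fun x =>
      mem_Icc.mpr ⟨minimalPeriod_perm_pos τ x, by
        have := card_fiber_orbits τ (Quotient.mk'' x)
        rw [orbitLength_mk] at this
        rw [← this]
        exact card_le_univ _⟩
    simp only [coe_filter, mem_product, Set.mem_ofPred_eq]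
    exact ⟨⟨hle _, hle _⟩, by rw [← minimalPeriod_prodCongr, hp']⟩

theorem card_fixedBy_table (g : Perm A × Perm B) :
    Nat.card (MulAction.fixedBy (Table A B) g) =
      fixedCount g.1.partition g.2.partition := by
  have h1 : Nat.card (MulAction.fixedBy (Table A B) g) =
      Nat.card {f : A × A → Option B //
        ∀ p, f ((g.1.prodCongr g.1) p) = (optionCongr g.2 : Perm (Option B)) (f p)} := by
    refine Nat.card_congr (Equiv.subtypeEquivRight fun f => ?_)
    refine (smul_table_eq_iff g f f).trans ?_
    simp [Prod.forall]
  rw [h1, card_equivariant]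
  have hpos : ∀ ω : Orbits (g.1.prodCongr g.1), orbitLength _ ω ≠ 0 := fun ω =>
    (minimalPeriod_perm_pos _ _).ne'
  set F : ℕ → ℕ := fun l => 1 + ∑ d ∈ l.divisors, d * mult g.2.partition d with hF
  rw [prod_congr rfl fun ω _ => card_optionCongr_pow_fixed g.2 (hpos ω)]
  rw [fixedCount, ← prod_product']
  set e : ℕ × ℕ → ℕ := fun q =>
    mult g.1.partition q.1 * mult g.1.partition q.2 * q.1.gcd q.2 with he
  set I := Icc 1 (Fintype.card A) ×ˢ Icc 1 (Fintype.card A) with hI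
  change ∏ ω, F (orbitLength _ ω) = ∏ q ∈ I, F (q.1.lcm q.2) ^ e q
  -- A common index set of nonzero lengths, so that both products can be regrouped by l and compared
  -- factor by factor.
  set T := I.image (fun q => q.1.lcm q.2) ∪ univ.image (orbitLength (g.1.prodCongr g.1)) with hT
  have hT0 : ∀ l ∈ T, l ≠ 0 := by
    intro l hl
    rw [hT, mem_union, mem_image, mem_image] at hl
    rcases hl with ⟨q, hq, rfl⟩ | ⟨ω, -, rfl⟩
    · rw [hI, mem_product, mem_Icc, mem_Icc] at hq
      exact Nat.lcm_ne_zero (by omega) (by omega)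
    · exact hpos ω
  rw [← prod_fiberwise_of_maps_to (s := univ) (t := T) (g := orbitLength (g.1.prodCongr g.1))
    fun ω _ => mem_union_right _ (mem_image_of_mem _ (mem_univ _)),
    ← prod_fiberwise_of_maps_to (s := I) (t := T) (g := fun q => q.1.lcm q.2)
    fun q hq => mem_union_left _ (mem_image_of_mem _ hq)]
  refine prod_congr rfl fun l hl => ?_
  rw [prod_congr rfl (g := fun _ => F l) fun ω hω => by rw [(mem_filter.mp hω).2], prod_const,
    prod_congr rfl (g := fun q => F l ^ e q) fun q hq => by rw [(mem_filter.mp hq).2],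
    prod_pow_eq_pow_sum, card_orbits_prod g.1 (hT0 l hl)]

/-- The number of orbits of tables. -/
noncomputable def numTables (A B : Type*) : ℕ :=
  Nat.card (MulAction.orbitRel.Quotient (Perm A × Perm B) (Table A B))

theorem numTables_eq_sum :
    (numTables A B : ℚ) = ∑ j : Nat.Partition (Fintype.card B),
      ∑ k : Nat.Partition (Fintype.card A),
        ((centralizerOrder j : ℚ) * centralizerOrder k)⁻¹ * fixedCount k j := by
  classical
  have : Fintype (Table A B) := Fintype.ofFinite _
  have : Fintype (MulAction.orbitRel.Quotient (Perm A × Perm B) (Table A B)) :=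
    Fintype.ofFinite _
  have h := MulAction.sum_card_fixedBy_eq_card_orbits_mul_card_group (Perm A × Perm B) (Table A B)
  rw [sum_congr rfl (g := fun g : Perm A × Perm B => fixedCount g.1.partition g.2.partition)
    fun g _ => by rw [← Nat.card_eq_fintype_card, card_fixedBy_table]] at h
  rw [Fintype.sum_prod_type_right, Fintype.card_prod, Fintype.card_perm, Fintype.card_perm] at h
  have h' := congrArg (Nat.cast : ℕ → ℚ) h
  push_cast at h'
  rw [sum_perm_partition (α := B)
    (fun j => ∑ τ : Perm A, (fixedCount τ.partition j : ℚ))] at h'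
  have hsum (j : Nat.Partition (Fintype.card B)) :=
    sum_perm_partition (α := A) (fun k => (fixedCount k j : ℚ))
  simp_rw [hsum] at h'
  rw [numTables, Nat.card_eq_fintype_card]
  have hA : ((Fintype.card A).factorial : ℚ) ≠ 0 := by exact_mod_cast Nat.factorial_ne_zero _
  have hB : ((Fintype.card B).factorial : ℚ) ≠ 0 := by exact_mod_cast Nat.factorial_ne_zero _
  apply mul_right_cancel₀ (mul_ne_zero hA hB)
  refine h'.symm.trans ?_
  rw [mul_sum, sum_mul]
  refine sum_congr rfl fun j _ => ?_
  rw [mul_sum, mul_sum, mul_sum, sum_mul]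
  refine sum_congr rfl fun k _ => ?_
  rw [mul_inv]
  ring

theorem numTables_fin (a b : ℕ) : (numTables (Fin a) (Fin b) : ℚ) = N (a + b + 1) (b + 1) := by
  have h := numTables_eq_sum (A := Fin a) (B := Fin b)
  rw [Fintype.card_fin, Fintype.card_fin] at h
  rw [h, N, Nat.add_sub_cancel, show a + b + 1 - (b + 1) = a by omega]
  refine sum_congr rfl fun j _ => sum_congr rfl fun k _ => ?_
  simp only [centralizerOrder, fixedCount]
  push_cast
  rfl

end Tables

/-! ### Tables in which every nonzero value occurs. -/

section Covering

variable {A B : Type*}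

/-- Tables up to relabelling of the rows (and columns) and of the nonzero entries. -/
abbrev TableClass (A B : Type*) : Type _ :=
  MulAction.orbitRel.Quotient (Perm A × Perm B) (Table A B)

/-- The class of a table. -/
def Table.toClass (f : Table A B) : TableClass A B := Quotient.mk'' f

theorem exists_toClass_eq (c : TableClass A B) : ∃ f : Table A B, f.toClass = c :=
  ⟨c.out, Quotient.out_eq' c⟩

theorem toClass_eq_iff (f f' : Table A B) :
    f.toClass = f'.toClass ↔
      ∃ (τ : Perm A) (σ : Perm B), ∀ x y, f' (τ x, τ y) = (f (x, y)).map σ := by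
  rw [eq_comm, Table.toClass, Table.toClass, Quotient.eq'']
  change f' ∈ MulAction.orbit _ f ↔ _
  simp only [MulAction.mem_orbit_iff, Prod.exists, smul_table_eq_iff]

/-- Two tables are in the same class as soon as a permutation of the rows respects zero entries
and equality of entries. -/
theorem toClass_eq_iff_kernel [Finite B] (f f' : Table A B) :
    f.toClass = f'.toClass ↔
      ∃ τ : Perm A, (∀ p, f p = none ↔ f' (τ p.1, τ p.2) = none) ∧
        ∀ p p', f p = f p' ↔ f' (τ p.1, τ p.2) = f' (τ p'.1, τ p'.2) := by
  rw [toClass_eq_iff]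
  constructor
  · rintro ⟨τ, σ, h⟩
    refine ⟨τ, fun p => by simp [h], fun p p' => ?_⟩
    rw [h, h]
    exact (Option.map_injective σ.injective).eq_iff.symm
  · rintro ⟨τ, h0, h1⟩
    refine ⟨τ, ?_⟩
    have hex : ∀ b : {b : B // ∃ p, f p = some b}, ∃ b' : B, ∀ p, f p = some b.1 →
        f' (τ p.1, τ p.2) = some b' := by
      rintro ⟨b, p, hp⟩
      have : f' (τ p.1, τ p.2) ≠ none := by
        rw [ne_eq, ← h0, hp]
        simp
      obtain ⟨b', hb'⟩ := Option.ne_none_iff_exists'.mp this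
      exact ⟨b', fun p' hp' => by rw [← hb', ← h1, hp', hp]⟩
    choose g hg using hex
    have hginj : Injective g := by
      rintro ⟨b, p, hp⟩ ⟨b', p', hp'⟩ h
      have e1 := hg ⟨b, p, hp⟩ p hp
      have e2 := hg ⟨b', p', hp'⟩ p' hp'
      rw [h, ← e2, ← h1, hp, hp'] at e1
      exact Subtype.ext (Option.some_injective _ e1)
    -- The matching `g` of occurring values is injective, so it extends to a permutation of the
    -- finite set B.
    obtain ⟨σ, hσ⟩ := Equiv.Perm.exists_extending_pair _ g Subtype.val_injective hginj
    refine ⟨σ, fun x y => ?_⟩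
    rcases h : f (x, y) with _ | b
    · exact (h0 _).mp h
    · have e := hg ⟨b, _, h⟩ (x, y) h
      rw [e, ← hσ]
      rfl

/-- Every nonzero element occurs in the table. -/
def Table.Covering (f : Table A B) : Prop := ∀ b : B, ∃ p, f p = some b

theorem covering_of_toClass_eq {f f' : Table A B} (h : f.toClass = f'.toClass)
    (hf : f.Covering) : f'.Covering := by
  obtain ⟨τ, σ, h⟩ := (toClass_eq_iff f f').mp h
  intro b
  obtain ⟨p, hp⟩ := hf (σ⁻¹ b)
  refine ⟨(τ p.1, τ p.2), ?_⟩
  rw [h, hp]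
  simp

/-- The classes of covering tables. -/
def coveringClasses (A B : Type*) : Set (TableClass A B) :=
  {c | ∃ f : Table A B, f.Covering ∧ f.toClass = c}

/-- A table with `b` nonzero elements viewed as a table with one more, which does not occur. -/
def Table.extend {b : ℕ} (f : Table A (Fin b)) : Table A (Fin (b + 1)) :=
  fun p => (f p).map Fin.castSucc

/-- The kernel criterion sees only zeros and coincidences of entries, which an injective renaming of
values preserves. -/
theorem toClass_extend_eq_iff {b : ℕ} (f f' : Table A (Fin b)) :
    f.extend.toClass = f'.extend.toClass ↔ f.toClass = f'.toClass := by
  rw [toClass_eq_iff_kernel, toClass_eq_iff_kernel]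
  simp only [Table.extend, Option.map_eq_none_iff,
    (Option.map_injective (Fin.castSucc_injective b)).eq_iff]

theorem exists_extend_toClass_eq_of_not_covering {b : ℕ} {f : Table A (Fin (b + 1))}
    (hf : ¬ f.Covering) : ∃ g : Table A (Fin b), g.extend.toClass = f.toClass := by
  simp only [Table.Covering, not_forall, not_exists] at hf
  obtain ⟨c, hc⟩ := hf
  have : ∀ p, ∃ o : Option (Fin b), o.map c.succAbove = f p := by
    intro p
    rcases h : f p with _ | d
    · exact ⟨none, rfl⟩
    · have hd : d ≠ c := by
        rintro rfl
        exact hc p h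
      obtain ⟨i, hi⟩ := Fin.exists_succAbove_eq hd
      exact ⟨some i, by rw [Option.map_some, hi]⟩
  choose g hg using this
  refine ⟨g, ?_⟩
  rw [toClass_eq_iff_kernel]
  -- Skipping the missing value `c` or the last value gives tables with the same kernel, so no row
  -- needs to move.
  refine ⟨1, fun p => ?_, fun p p' => ?_⟩
  · simp [Table.extend, ← hg]
  · simp only [Table.extend, Perm.coe_one, id_eq, ← hg,
      (Option.map_injective (Fin.castSucc_injective b)).eq_iff,
      (Option.map_injective (Fin.succAbove_right_injective (p := c))).eq_iff]

theorem not_covering_extend {b : ℕ} (f : Table A (Fin b)) : ¬ f.extend.Covering := by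
  intro h
  obtain ⟨p, hp⟩ := h (Fin.last b)
  obtain ⟨i, -, hi⟩ := Option.map_eq_some_iff.mp hp
  exact (Fin.castSucc_lt_last i).ne hi

theorem card_coveringClasses_add [Finite A] (b : ℕ) :
    Nat.card (coveringClasses A (Fin (b + 1))) + numTables A (Fin b) =
      numTables A (Fin (b + 1)) := by
  have hcompl : Nat.card ((coveringClasses A (Fin (b + 1)))ᶜ : Set _) = numTables A (Fin b) := by
    symm
    choose r hr using exists_toClass_eq (A := A) (B := Fin b)
    refine Nat.card_eq_of_bijective
      (fun c => ⟨(r c).extend.toClass, ?_⟩) ⟨?_, ?_⟩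
    · rintro ⟨f, hf, h⟩
      exact not_covering_extend _ (covering_of_toClass_eq h hf)
    · intro c c' h
      have h' := congrArg Subtype.val h
      simp only [toClass_extend_eq_iff, hr] at h'
      exact h'
    · rintro ⟨c, hc⟩
      obtain ⟨f, rfl⟩ := exists_toClass_eq c
      have hf : ¬ f.Covering := fun hf => hc ⟨f, hf, rfl⟩
      obtain ⟨g, hg⟩ := exists_extend_toClass_eq_of_not_covering hf
      refine ⟨g.toClass, Subtype.ext ?_⟩
      exact ((toClass_extend_eq_iff _ _).mpr (hr _)).trans hg
  rw [← hcompl, numTables]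
  have := Set.ncard_add_ncard_compl (coveringClasses A (Fin (b + 1)))
  rwa [← Nat.card_coe_set_eq, ← Nat.card_coe_set_eq] at this

theorem coveringClasses_eq_empty [Finite A] {b : ℕ} (h : Nat.card A ^ 2 < b) :
    coveringClasses A (Fin b) = ∅ := by
  rw [Set.eq_empty_iff_forall_notMem]
  rintro _ ⟨f, hf, -⟩
  choose g hg using hf
  have hinj : Injective g := fun x y hxy => by
    have := hg x
    rw [hxy, hg y] at this
    exact (Option.some_injective _ this).symm
  have := Nat.card_le_card_of_injective g hinj
  rw [Nat.card_prod, Nat.card_fin, ← sq] at this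
  omega

end Covering

/-! ### Semigroups of degree 3 as covering tables. -/

section Structure

theorem productSet_two (S : Type*) [Semigroup S] :
    productSet S 2 = {x | ∃ y s : S, x = y * s} := by
  ext x
  simp [productSet]

theorem productSet_three (S : Type*) [Semigroup S] :
    productSet S 3 = {x | ∃ y s t : S, x = y * s * t} := by
  ext x
  change (∃ y ∈ productSet S 2, ∃ s, x = y * s) ↔ _
  rw [productSet_two]
  constructor
  · rintro ⟨_, ⟨y, s, rfl⟩, t, rfl⟩
    exact ⟨y, s, t, rfl⟩
  · rintro ⟨y, s, t, rfl⟩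
    exact ⟨_, ⟨y, s, rfl⟩, t, rfl⟩

theorem isNilpotentOfDegree_three_iff (S : Type*) [Semigroup S] :
    IsNilpotentOfDegree S 3 ↔
      ∃ z : S, (∀ x y w : S, x * y * w = z) ∧ ∃ x y : S, x * y ≠ z := by
  constructor
  · rintro ⟨⟨-, h3⟩, hmin⟩
    obtain ⟨z, hz⟩ := Set.ncard_eq_one.mp h3
    rw [productSet_three] at hz
    have hz' : ∀ x y w : S, x * y * w = z := fun x y w => by
      have : x * y * w ∈ ({z} : Set S) := hz ▸ ⟨x, y, w, rfl⟩
      exact this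
    refine ⟨z, hz', ?_⟩
    by_contra! hne
    have h2 : productSet S 2 = {z} := by
      rw [productSet_two]
      ext x
      simp only [hne, Set.mem_ofPred_eq, Set.mem_singleton_iff]
      exact ⟨fun ⟨_, _, h⟩ => h, fun h => ⟨z, z, h⟩⟩
    have := hmin (show (2 : ℕ) ∈ {t : ℕ | 1 ≤ t ∧ (productSet S t).ncard = 1} from
      ⟨by norm_num, by rw [h2, Set.ncard_singleton]⟩)
    omega
  · rintro ⟨z, hz, x, y, hxy⟩
    refine ⟨⟨by norm_num, ?_⟩, ?_⟩
    · rw [Set.ncard_eq_one]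
      refine ⟨z, ?_⟩
      rw [productSet_three]
      ext w
      simp only [hz, Set.mem_ofPred_eq, Set.mem_singleton_iff]
      exact ⟨fun ⟨_, _, _, h⟩ => h, fun h => ⟨z, z, z, h⟩⟩
    · rintro t ⟨ht1, ht⟩
      by_contra! hlt
      obtain ⟨c, hc⟩ := Set.ncard_eq_one.mp ht
      obtain rfl | rfl : t = 1 ∨ t = 2 := by omega
      · have hall : ∀ w : S, w = c := fun w => by
          have : w ∈ productSet S 1 := Set.mem_univ w
          rwa [hc] at this
        exact hxy ((hall _).trans (hall _).symm)
      · rw [productSet_two] at hc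
        have hall : ∀ u v : S, u * v = c := fun u v => by
          have : u * v ∈ ({c} : Set S) := hc ▸ ⟨u, v, rfl⟩
          exact this
        exact hxy ((hall x y).trans ((hall (z * z) z).symm.trans (hz z z z)))

theorem ncard_productSet_two_eq_of_mulEquiv {S S' : Type*} [Semigroup S] [Semigroup S']
    (φ : S ≃* S') : (productSet S 2).ncard = (productSet S' 2).ncard := by
  rw [← Set.ncard_image_of_injective _ φ.injective, productSet_two, productSet_two]
  congr 1
  ext x
  constructor
  · rintro ⟨_, ⟨y, w, rfl⟩, rfl⟩
    exact ⟨φ y, φ w, map_mul φ y w⟩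
  · rintro ⟨y, w, rfl⟩
    exact ⟨_, ⟨φ.symm y, φ.symm w, rfl⟩, by simp⟩

theorem one_lt_ncard_productSet_two {S : Type*} [Finite S] [Semigroup S]
    (hs : IsNilpotentOfDegree S 3) : 1 < (productSet S 2).ncard := by
  obtain ⟨z, hz, x, y, hxy⟩ := (isNilpotentOfDegree_three_iff S).mp hs
  rw [Set.one_lt_ncard, productSet_two]
  exact ⟨x * y, ⟨x, y, rfl⟩, z, ⟨z * z, z, (hz z z z).symm⟩, hxy⟩

variable {A B : Type*}

/-- The product defined by a table: everything outside `A × A` multiplies to zero. -/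
def Table.op (f : Table A B) : A ⊕ Option B → A ⊕ Option B → A ⊕ Option B
  | .inl x, .inl y => .inr (f (x, y))
  | _, _ => .inr none

@[simp] theorem Table.op_inl_inl (f : Table A B) (x y : A) :
    f.op (.inl x) (.inl y) = .inr (f (x, y)) := rfl

@[simp] theorem Table.op_inr_left (f : Table A B) (o : Option B) (c : A ⊕ Option B) :
    f.op (.inr o) c = .inr none := by
  cases c <;> rfl

@[simp] theorem Table.op_inr_right (f : Table A B) (c : A ⊕ Option B) (o : Option B) :
    f.op c (.inr o) = .inr none := by
  cases c <;> rfl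

theorem Table.exists_op_eq_inr (f : Table A B) (c d : A ⊕ Option B) :
    ∃ o, f.op c d = .inr o := by
  cases c <;> cases d <;> exact ⟨_, rfl⟩

theorem Table.Covering.exists_op {f : Table A B} (hf : f.Covering) (o : Option B) :
    ∃ c d, f.op c d = .inr o := by
  cases o with
  | none => exact ⟨.inr none, .inr none, rfl⟩
  | some b =>
    obtain ⟨p, hp⟩ := hf b
    exact ⟨.inl p.1, .inl p.2, by rw [Table.op_inl_inl, hp]⟩

/-- An isomorphism from the structure given by a table to a semigroup. -/
structure Presentation (f : Table A B) {S : Type*} (s : Semigroup S) where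
  /-- The underlying bijection. -/
  toEquiv : A ⊕ Option B ≃ S
  map_op : ∀ c d, toEquiv (f.op c d) = toEquiv c * toEquiv d

theorem Presentation.productSet_two {f : Table A B} (hf : f.Covering) {S : Type*}
    {s : Semigroup S} (P : Presentation f s) :
    productSet S 2 = Set.range fun o => P.toEquiv (.inr o) := by
  rw [NilpotentCount.productSet_two]
  ext x
  constructor
  · rintro ⟨y, t, rfl⟩
    obtain ⟨c, rfl⟩ := P.toEquiv.surjective y
    obtain ⟨d, rfl⟩ := P.toEquiv.surjective t
    obtain ⟨o, ho⟩ := f.exists_op_eq_inr c d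
    exact ⟨o, by rw [← P.map_op, ho]⟩
  · rintro ⟨o, rfl⟩
    obtain ⟨c, d, h⟩ := hf.exists_op o
    exact ⟨P.toEquiv c, P.toEquiv d, by rw [← P.map_op, h]⟩

theorem Presentation.ncard_productSet_two [Finite B] {f : Table A B} (hf : f.Covering) {S : Type*}
    {s : Semigroup S} (P : Presentation f s) : (productSet S 2).ncard = Nat.card B + 1 := by
  rw [P.productSet_two hf, ← Nat.card_coe_set_eq,
    Nat.card_range_of_injective fun _ _ h => Sum.inr_injective (P.toEquiv.injective h),
    Finite.card_option]

/-- The semigroup given by a table. -/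
abbrev Table.semigroup (f : Table A B) : Semigroup (A ⊕ Option B) where
  mul := f.op
  mul_assoc c d e := by
    change f.op (f.op c d) e = f.op c (f.op d e)
    obtain ⟨o, ho⟩ := f.exists_op_eq_inr c d
    obtain ⟨o', ho'⟩ := f.exists_op_eq_inr d e
    rw [ho, ho', Table.op_inr_left, Table.op_inr_right]

theorem exists_presentation_of_equiv (f : Table A B) {S : Type*} (e : A ⊕ Option B ≃ S) :
    ∃ s : Semigroup S, Nonempty (Presentation f s) := by
  let _ := f.semigroup
  refine ⟨e.symm.semigroup, ⟨⟨e, fun c d => ?_⟩⟩⟩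
  change e (f.op c d) = e (f.op (e.symm (e c)) (e.symm (e d)))
  simp

theorem Presentation.isNilpotentOfDegree_three [Nonempty B] {f : Table A B} (hf : f.Covering)
    {S : Type*} {s : Semigroup S} (P : Presentation f s) : IsNilpotentOfDegree S 3 := by
  rw [isNilpotentOfDegree_three_iff]
  refine ⟨P.toEquiv (.inr none), fun x y w => ?_, ?_⟩
  · obtain ⟨c, rfl⟩ := P.toEquiv.surjective x
    obtain ⟨d, rfl⟩ := P.toEquiv.surjective y
    obtain ⟨e, rfl⟩ := P.toEquiv.surjective w
    obtain ⟨o, ho⟩ := f.exists_op_eq_inr c d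
    rw [← P.map_op, ← P.map_op, ho, Table.op_inr_left]
  · obtain ⟨b⟩ := ‹Nonempty B›
    obtain ⟨c, d, h⟩ := hf.exists_op (some b)
    refine ⟨P.toEquiv c, P.toEquiv d, ?_⟩
    rw [← P.map_op, h]
    simp

theorem exists_presentation {S : Type*} [Finite S] (s : Semigroup S)
    (hs : IsNilpotentOfDegree S 3) {a b : ℕ} (hb : (productSet S 2).ncard = b + 1)
    (hab : Nat.card S = a + (b + 1)) :
    ∃ f : Table (Fin a) (Fin b), f.Covering ∧ Nonempty (Presentation f s) := by
  classical
  obtain ⟨z, hz, -⟩ := (isNilpotentOfDegree_three_iff S).mp hs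
  set T := productSet S 2 with hT
  have hmem : ∀ x y : S, x * y ∈ T := fun x y => by
    rw [hT, productSet_two]; exact ⟨x, y, rfl⟩
  have hT2 : ∀ w ∈ T, ∃ x y, w = x * y := fun w hw => by
    rwa [hT, productSet_two] at hw
  have hzT : z ∈ T := hz z z z ▸ hmem _ _
  have hleft : ∀ u ∈ T, ∀ v, u * v = z := fun u hu v => by
    obtain ⟨x, y, rfl⟩ := hT2 u hu
    exact hz x y v
  have hright : ∀ u, ∀ v ∈ T, u * v = z := fun u v hv => by
    obtain ⟨x, y, rfl⟩ := hT2 v hv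
    rw [← mul_assoc]
    exact hz u x y
  have hcT : Nat.card (Option (Fin b)) = Nat.card T := by
    rw [Finite.card_option, Nat.card_fin, Nat.card_coe_set_eq, hb]
  have hcTc : Nat.card (Fin a) = Nat.card (Tᶜ : Set S) := by
    have := Set.ncard_add_ncard_compl T
    rw [Nat.card_fin, Nat.card_coe_set_eq]
    omega
  let eT0 : Option (Fin b) ≃ T := (Finite.card_eq.mp hcT).some
  let eA : Fin a ≃ (Tᶜ : Set S) := (Finite.card_eq.mp hcTc).some
  -- The swap makes `none` correspond to the zero z.
  let eT : Option (Fin b) ≃ T := eT0.trans (Equiv.swap (eT0 none) ⟨z, hzT⟩)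
  have heT : eT none = ⟨z, hzT⟩ := by simp [eT]
  let e : Fin a ⊕ Option (Fin b) ≃ S :=
    (Equiv.sumCongr eA eT).trans ((Equiv.sumComm _ _).trans (Equiv.Set.sumCompl T))
  have he1 : ∀ x, e (.inl x) = (eA x).1 := fun x => by simp [e]
  have he2 : ∀ o, e (.inr o) = (eT o).1 := fun o => by simp [e]
  let f : Table (Fin a) (Fin b) := fun p => eT.symm ⟨(eA p.1).1 * (eA p.2).1, hmem _ _⟩
  have hf : ∀ p, (eT (f p)).1 = (eA p.1).1 * (eA p.2).1 := fun p => by simp [f]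
  refine ⟨f, fun i => ?_, ⟨⟨e, fun c d => ?_⟩⟩⟩
  · obtain ⟨u, v, huv⟩ := hT2 _ (eT (some i)).2
    have hne : u * v ≠ z := fun h => by
      rw [h] at huv
      have : eT (some i) = eT none := by rw [heT]; exact Subtype.ext huv
      exact Option.some_ne_none _ (eT.injective this)
    have hu : u ∈ Tᶜ := fun h => hne (hleft u h v)
    have hv : v ∈ Tᶜ := fun h => hne (hright u v h)
    refine ⟨(eA.symm ⟨u, hu⟩, eA.symm ⟨v, hv⟩), eT.injective (Subtype.ext ?_)⟩
    rw [hf, huv]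
    simp
  · rcases c with x | o
    · rcases d with y | o
      · rw [Table.op_inl_inl, he1, he1, he2, hf]
      · rw [Table.op_inr_right, he2, he2, heT, hright _ _ (eT o).2]
    · rw [Table.op_inr_left, he2, he2, heT, hleft _ (eT o).2]

/-- Since both tables cover, the `inr` part is exactly the set of products, so an isomorphism
preserves it, its complement and the zero; its restriction to A is the required row permutation. -/
theorem toClass_eq_of_mulEquiv [Finite A] [Finite B] {f f' : Table A B} (hf : f.Covering)
    (hf' : f'.Covering) {S S' : Type*} {s : Semigroup S} {s' : Semigroup S'}
    (P : Presentation f s) (P' : Presentation f' s') (φ : S ≃* S') :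
    f.toClass = f'.toClass := by
  let ψ : A ⊕ Option B ≃ A ⊕ Option B := P.toEquiv.trans (φ.toEquiv.trans P'.toEquiv.symm)
  have hψ : ∀ c d, ψ (f.op c d) = f'.op (ψ c) (ψ d) := fun c d => by
    apply P'.toEquiv.injective
    rw [P'.map_op]
    simp [ψ, P.map_op]
  have hinr : ∀ o, ∃ o', ψ (.inr o) = .inr o' := fun o => by
    obtain ⟨c, d, h⟩ := hf.exists_op o
    rw [← h, hψ]
    exact f'.exists_op_eq_inr _ _
  have hnone : ψ (.inr none) = .inr none := by
    obtain ⟨o, ho⟩ := hinr none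
    have := hψ (.inr none) (.inr none)
    rwa [Table.op_inr_left, ho, Table.op_inr_left, ← ho] at this
  have hinl : ∀ x, ∃ y, ψ (.inl x) = .inl y := fun x => by
    rcases h : ψ (.inl x) with y | o
    · exact ⟨y, rfl⟩
    · obtain ⟨c, d, hcd⟩ := hf'.exists_op o
      rw [← hcd, ← ψ.apply_symm_apply c, ← ψ.apply_symm_apply d, ← hψ] at h
      obtain ⟨o', ho'⟩ := f.exists_op_eq_inr (ψ.symm c) (ψ.symm d)
      have := ψ.injective h
      rw [ho'] at this
      cases this
  choose t ht using hinl
  have htinj : Injective t := fun x y hxy => by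
    have := (ht x).trans ((congrArg Sum.inl hxy).trans (ht y).symm)
    exact Sum.inl_injective (ψ.injective this)
  have key : ∀ p : A × A, ψ (.inr (f p)) = .inr (f' (t p.1, t p.2)) := fun p => by
    have := hψ (.inl p.1) (.inl p.2)
    rwa [Table.op_inl_inl, ht, ht, Table.op_inl_inl] at this
  rw [toClass_eq_iff_kernel]
  refine ⟨Equiv.ofBijective t (Finite.injective_iff_bijective.mp htinj), fun p => ?_,
    fun p p' => ?_⟩
  · simp only [Equiv.ofBijective_apply]
    rw [← (Sum.inr_injective (α := A)).eq_iff (a := f' _), ← key, ← hnone, ψ.injective.eq_iff,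
      (Sum.inr_injective (α := A)).eq_iff]
  · simp only [Equiv.ofBijective_apply]
    rw [← (Sum.inr_injective (α := A)).eq_iff (a := f' _), ← key, ← key, ψ.injective.eq_iff,
      (Sum.inr_injective (α := A)).eq_iff]

theorem mulEquiv_of_toClass_eq {f f' : Table A B} {S S' : Type*} {s : Semigroup S}
    {s' : Semigroup S'} (P : Presentation f s) (P' : Presentation f' s')
    (h : f.toClass = f'.toClass) : Nonempty (S ≃* S') := by
  obtain ⟨τ, σ, h⟩ := (toClass_eq_iff f f').mp h
  let ψ : A ⊕ Option B ≃ A ⊕ Option B := Equiv.sumCongr τ (Equiv.optionCongr σ)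
  have hψ : ∀ c d, ψ (f.op c d) = f'.op (ψ c) (ψ d) := by
    rintro (x | o) (y | o') <;> simp [ψ, h]
  refine ⟨⟨P.toEquiv.symm.trans (ψ.trans P'.toEquiv), fun x y => ?_⟩⟩
  obtain ⟨c, rfl⟩ := P.toEquiv.surjective x
  obtain ⟨d, rfl⟩ := P.toEquiv.surjective y
  simp [← P.map_op, ← P'.map_op, hψ]

end Structure

/-! ### Sorting isomorphism classes by |S²|. -/

section Counting

variable {n : ℕ}

instance (n : ℕ) : Finite (NilThree n) := by
  have : Injective fun s : NilThree n => fun x y : Fin n => s.1.mul x y := by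
    intro s t h
    apply Subtype.ext
    apply Semigroup.ext
    exact h
  exact Finite.of_injective _ this

/-- The number of products of two elements. -/
noncomputable def squareCard (s : NilThree n) : ℕ := (@productSet (Fin n) s.1 2).ncard

theorem squareCard_eq_of_iso {s t : NilThree n} (h : isoSetoid n s t) :
    squareCard s = squareCard t := by
  obtain ⟨φ⟩ := h
  exact @ncard_productSet_two_eq_of_mulEquiv _ _ s.1 t.1 φ

/-- The number of products of two elements, on isomorphism classes. -/
noncomputable def squareCardClass : Quotient (isoSetoid n) → ℕ :=
  Quotient.lift squareCard fun _ _ => squareCard_eq_of_iso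

theorem two_le_squareCardClass (q : Quotient (isoSetoid n)) : 2 ≤ squareCardClass q := by
  induction q using Quotient.inductionOn with | h s =>
  exact @one_lt_ncard_productSet_two _ _ s.1 s.2

theorem squareCardClass_le (q : Quotient (isoSetoid n)) : squareCardClass q ≤ n := by
  induction q using Quotient.inductionOn with | h s =>
  change (@productSet (Fin n) s.1 2).ncard ≤ n
  exact (Set.ncard_le_card _).trans (by simp)

theorem card_squareCardClass_eq (a b : ℕ) (hb : 1 ≤ b) (hab : n = a + (b + 1)) :
    Nat.card {q : Quotient (isoSetoid n) // squareCardClass q = b + 1} =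
      Nat.card (coveringClasses (Fin a) (Fin b)) := by
  symm
  -- A nonzero value is needed for the degree to be exactly 3.
  have : Nonempty (Fin b) := ⟨⟨0, hb⟩⟩
  have e : Fin a ⊕ Option (Fin b) ≃ Fin n :=
    (Finite.card_eq.mp (by simp [hab])).some
  have hex : ∀ c : coveringClasses (Fin a) (Fin b), ∃ (f : Table (Fin a) (Fin b)) (s : NilThree n),
      f.Covering ∧ f.toClass = c.1 ∧ Nonempty (Presentation f s.1) := by
    rintro ⟨c, f, hf, hc⟩
    obtain ⟨s, ⟨P⟩⟩ := exists_presentation_of_equiv f e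
    exact ⟨f, ⟨s, P.isNilpotentOfDegree_three hf⟩, hf, hc, ⟨P⟩⟩
  choose f s hf hfc P using hex
  refine Nat.card_eq_of_bijective (fun c => ⟨Quotient.mk _ (s c), ?_⟩) ⟨?_, ?_⟩
  · obtain ⟨P⟩ := P c
    change squareCard (s c) = _
    rw [squareCard, P.ncard_productSet_two (hf c), Nat.card_fin]
  · intro c c' h
    obtain ⟨φ⟩ := Quotient.exact (congrArg Subtype.val h)
    obtain ⟨P1⟩ := P c
    obtain ⟨P2⟩ := P c'
    apply Subtype.ext
    rw [← hfc, ← hfc]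
    exact toClass_eq_of_mulEquiv (hf c) (hf c') P1 P2 φ
  · rintro ⟨q, hq⟩
    induction q using Quotient.inductionOn with | h t =>
    obtain ⟨g, hg, ⟨Pg⟩⟩ := exists_presentation t.1 t.2 (a := a) (b := b) hq (by simp [hab])
    refine ⟨⟨g.toClass, g, hg, rfl⟩, Subtype.ext (Quotient.sound ?_)⟩
    obtain ⟨P1⟩ := P ⟨g.toClass, g, hg, rfl⟩
    exact mulEquiv_of_toClass_eq P1 Pg (hfc _)

/-- The condition is √(a + b + 1/4) ≤ a + 1/2; squaring leaves b ≤ a². -/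
theorem le_upper_iff (a b : ℕ) : b + 1 ≤ upper (a + (b + 1)) ↔ b ≤ a ^ 2 := by
  have ha : (0 : ℝ) ≤ a := a.cast_nonneg
  have hb : (0 : ℝ) ≤ b := b.cast_nonneg
  rw [upper, Nat.le_floor_iff' (by omega), ← Nat.cast_le (α := ℝ)]
  push_cast
  have : ((b : ℝ) + 1 ≤ a + (b + 1) + 1 / 2 - √(a + (b + 1) - 3 / 4)) ↔
      √((a : ℝ) + (b + 1) - 3 / 4) ≤ a + 1 / 2 := by
    constructor <;> intro h <;> linarith
  rw [this, Real.sqrt_le_left (by linarith)]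
  constructor <;> intro h <;> nlinarith

theorem upper_le (hn : 1 ≤ n) : upper n ≤ n := by
  have hn' : (1 : ℝ) ≤ n := by exact_mod_cast hn
  apply Nat.floor_le_of_le
  have : (1 / 2 : ℝ) ≤ √((n : ℝ) - 3 / 4) := Real.le_sqrt_of_sq_le (by nlinarith)
  linarith

theorem numNilThreeUpToIso_eq_sum (hn : 1 ≤ n) :
    numNilThreeUpToIso n =
      ∑ m ∈ Icc 2 (upper n), Nat.card (coveringClasses (Fin (n - m)) (Fin (m - 1))) := by
  classical
  have := Fintype.ofFinite (Quotient (isoSetoid n))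
  have h1 : numNilThreeUpToIso n = ∑ m ∈ Icc 2 n,
      Nat.card {q : Quotient (isoSetoid n) // squareCardClass q = m} := by
    rw [numNilThreeUpToIso, Nat.card_eq_fintype_card, ← card_univ,
      card_eq_sum_card_fiberwise (f := squareCardClass) (t := Icc 2 n)
        fun q _ => mem_coe.mpr (mem_Icc.mpr ⟨two_le_squareCardClass q, squareCardClass_le q⟩)]
    exact sum_congr rfl fun m _ => by rw [Nat.card_eq_fintype_card, Fintype.card_subtype]
  have h2 : ∀ m ∈ Icc 2 n, Nat.card {q : Quotient (isoSetoid n) // squareCardClass q = m} =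
      Nat.card (coveringClasses (Fin (n - m)) (Fin (m - 1))) := fun m hm => by
    rw [mem_Icc] at hm
    rw [← card_squareCardClass_eq (n := n) (n - m) (m - 1) (by omega) (by omega),
      show m - 1 + 1 = m by omega]
  rw [h1, sum_congr rfl h2]
  symm
  -- Beyond `upper n` there are more nonzero values than cells of the table, so nothing covers.
  refine sum_subset (Icc_subset_Icc_right (upper_le hn)) fun m hm hm' => ?_
  rw [mem_Icc] at hm hm'
  rw [coveringClasses_eq_empty, Nat.card_of_isEmpty]
  rw [Nat.card_fin]
  by_contra! hle
  rw [← le_upper_iff, show m - 1 + 1 = m by omega, show n - m + m = n by omega] at hle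
  omega

end Counting

end NilpotentCount

theorem theorem2p2 (n : ℕ) (hn : 1 ≤ n) :
    (NilpotentCount.numNilThreeUpToIso n : ℚ) =
      ∑ m ∈ Finset.Icc 2 (NilpotentCount.upper n),
        (NilpotentCount.N n m - NilpotentCount.N (n - 1) (m - 1)) := by
  rw [NilpotentCount.numNilThreeUpToIso_eq_sum hn, Nat.cast_sum]
  refine Finset.sum_congr rfl fun m hm => ?_
  rw [Finset.mem_Icc] at hm
  have hmn := hm.2.trans (NilpotentCount.upper_le hn)
  obtain ⟨b, rfl⟩ : ∃ b, m = b + 2 := ⟨m - 2, by omega⟩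
  obtain ⟨a, rfl⟩ : ∃ a, n = a + b + 2 := ⟨n - (b + 2), by omega⟩
  have h := NilpotentCount.card_coveringClasses_add (A := Fin a) b
  have h1 := NilpotentCount.numTables_fin a (b + 1)
  have h2 := NilpotentCount.numTables_fin a b
  rw [show a + b + 2 - (b + 2) = a by omega, show b + 2 - 1 = b + 1 by omega,
    show a + b + 2 - 1 = a + b + 1 by omega, ← h2,
    show a + b + 2 = a + (b + 1) + 1 by omega, ← h1, ← h]
  push_cast
  ring
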